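/- For real $x$ let $G(x)=2\,\dfrac{e^x-1-x}{x^2}$ for $x\neq 0$ and $G(0)=1$, that is, $G(x)=2\sum_{j\ge 0}\dfrac{x^j}{(j+2)!}$ (the normalized left truncated exponential). For each integer $k\ge 0$ the function $G^{-\frac{2k+1}{2}}$ is infinitely differentiable at $0$; put $$a_k=\frac{1}{2^k\,k!}\,\partial^{2k}\bigl(G^{-\frac{2k+1}{2}}\bigr)(0),$$ where $\partial^{m}$ denotes the $m$-th derivative. Then the $a_k$ are the coefficients of the asymptotic expansion of $n!$, $$n!\asymp\sqrt{2\pi n}\,e^{-n}n^n\sum_{k\ge 0}\frac{a_k}{n^k}\qquad(n\to\infty),$$ meaning that for every integer $N\ge 0$ and all integers $n\ge 1$, $$n!=\sqrt{2\pi n}\,e^{-n}n^n\Bigl(\sum_{k=0}^{N}\frac{a_k}{n^k}+R_{N+1}(n)\Bigr),\qquad R_{N+1}(n)=O\bigl(n^{-(N+1)}\bigr)\ \text{ as } n\to\infty .$$ Moreover, the $a_k$ are the only real numbers for which this expansion holds. -/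

import Mathlib

open Filter Asymptotics

/-- The normalized left truncated exponential `G x = 2 (e ^ x - 1 - x) / x ^ 2`, with the removable
singularity at `0` filled in by its limit `1`. -/
noncomputable def truncExp (x : ℝ) : ℝ :=
  if x = 0 then 1 else 2 * (Real.exp x - 1 - x) / x ^ 2

/-- The function `G ^ (-(2 k + 1) / 2)` of a real variable. The base is positive everywhere. -/
noncomputable def truncExpPow (k : ℕ) (x : ℝ) : ℝ :=
  truncExp x ^ (-((2 * (k : ℝ) + 1) / 2))

/-- `a_k = (1 / (2 ^ k k!)) ∂ ^ (2 k) (G ^ (-(2 k + 1) / 2)) (0)`. -/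
noncomputable def stirlingCoeff (k : ℕ) : ℝ :=
  1 / (2 ^ k * (k.factorial : ℝ)) * iteratedDeriv (2 * k) (truncExpPow k) 0

/-- `u n ≍ p n * ∑ a k / n ^ k` as an asymptotic expansion in inverse powers of `n`: for every
`N`, one has `u n = p n * (∑ k ≤ N, a k / n ^ k + R n)` for all `n ≥ 1`, where
`R n = O (1 / n ^ (N + 1))` as `n → ∞`. -/
def HasInvPowExpansion (u p a : ℕ → ℝ) : Prop :=
  ∀ N : ℕ, ∃ R : ℕ → ℝ,
    (∀ n : ℕ, 1 ≤ n →
      u n = p n * (∑ k ∈ Finset.range (N + 1), 1 / (n : ℝ) ^ k * a k + R n)) ∧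
    R =O[atTop] (fun n : ℕ => 1 / (n : ℝ) ^ (N + 1))

/-! Substituting `n * exp x` in the Gamma integral turns `n!` into `n ^ (n+1) * e ^ (-n)` times the
integral of `exp (-n (e^x - 1 - x))`. With `φ x = x * G(x)^(1/2)` the phase is `φ² / 2`, so in the
variable `u = φ x` this is a Gaussian integral against the derivative of the inverse of `φ`. By
Lagrange inversion the `u^j` coefficient `c_j` of that derivative is the `x^j` coefficient of
`G^(-(j+1)/2)`. Odd Gaussian moments vanish, and the moment of order `2k` turns `c_{2k}` into `sqrt
(2π/n) * a_k / n^k`.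

The inverse function is never constructed. Instead `1` is approximated by `∑_{j<2K} c_j φ^j φ'` up
to `O(x^(2K))` (`one_sub_sum_expPhase_isBigO`). Each term becomes a truncated Gaussian moment by
exact substitution, the remainder costs a relative `n^(-K)`
(`exists_intervalIntegral_mul_exp_isBigO`), and all tails are exponentially small. -/

/-! ### Lagrange inversion for formal power series -/

section LagrangeInversion

open PowerSeries

variable {K : Type*} [Field K] [CharZero K] {h p : PowerSeries K}

/-- This coefficient is the residue of `φ' / φ^(k+1)` for `φ = X * h`: a logarithmic derivative when
`k = 0`, and otherwise the exact derivative of `-φ^(-k) / k`. -/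
theorem PowerSeries.coeff_pow_mul_derivative_X_mul (hp : h * p = 1) (k : ℕ) :
    coeff k (p ^ (k + 1) * derivative K (X * h)) = if k = 0 then 1 else 0 := by
  have hd : derivative K h * p + h * derivative K p = 0 := by
    have := congrArg (derivative K) hp
    rw [Derivation.leibniz, derivative_one, smul_eq_mul, smul_eq_mul] at this
    linear_combination this
  have hX : derivative K (X * h) = h + X * derivative K h := by
    rw [Derivation.leibniz, derivative_X, smul_eq_mul, smul_eq_mul]; ring
  rcases k with _ | k
  · have : p ^ (0 + 1) * derivative K (X * h) = 1 + X * (p * derivative K h) := by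
      rw [hX]; linear_combination hp
    rw [this, map_add, coeff_zero_X_mul]; simp
  · have hk : (k + 1 : K) ≠ 0 := by exact_mod_cast Nat.succ_ne_zero k
    -- Exactness without Laurent series: in degree `k + 1` the operator `X * d/dX` multiplies by `k
    -- + 1`, so the right side cancels.
    have key : (C (k + 1 : K)) * (p ^ (k + 1 + 1) * derivative K (X * h)) =
        C (k + 1 : K) * p ^ (k + 1) - X * derivative K (p ^ (k + 1)) := by
      rw [hX, derivative_pow]
      simp only [map_add, map_natCast, map_one, Nat.cast_add, Nat.cast_one, Nat.add_sub_cancel]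
      linear_combination ((k : PowerSeries K) + 1) * p ^ (k + 1) * (hp + X * hd)
        - ((k : PowerSeries K) + 1) * p ^ k * X * derivative K p * hp
    have := congrArg (coeff (k + 1)) key
    rw [map_sub, coeff_C_mul, coeff_C_mul, coeff_succ_X_mul, coeff_derivative] at this
    have h0 : (k + 1 : K) * coeff (k + 1) (p ^ (k + 1 + 1) * derivative K (X * h)) = 0 := by
      rw [this]; ring
    simpa [hk] using h0

theorem PowerSeries.coeff_pow_mul_pow_mul_derivative_X_mul (hp : h * p = 1) {j m : ℕ} :
    coeff m (p ^ (m + 1) * ((X * h) ^ j * derivative K (X * h))) = if j = m then 1 else 0 := by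
  have hjp : ∀ i : ℕ, h ^ i * p ^ i = 1 := fun i => by rw [← mul_pow, hp, one_pow]
  rcases le_or_gt j m with hjm | hjm
  · obtain ⟨k, rfl⟩ := Nat.exists_eq_add_of_le hjm
    have : p ^ (j + k + 1) * ((X * h) ^ j * derivative K (X * h)) =
        X ^ j * (p ^ (k + 1) * derivative K (X * h)) := by
      have := hjp j
      rw [mul_pow, show j + k + 1 = j + (k + 1) by ring, pow_add p]
      linear_combination X ^ j * p ^ (k + 1) * derivative K (X * h) * this
    rw [this, add_comm j k, coeff_X_pow_mul, coeff_pow_mul_derivative_X_mul hp]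
    simp
  · rw [if_neg hjm.ne', mul_pow,
      show p ^ (m + 1) * (X ^ j * h ^ j * derivative K (X * h)) =
        X ^ j * (p ^ (m + 1) * h ^ j * derivative K (X * h)) by ring,
      coeff_X_pow_mul', if_neg (by omega)]

/-- Lagrange inversion: if `φ = X * h` and `p = h⁻¹`, the numbers `coeff j (p ^ (j + 1))` are the
coefficients of the derivative of the compositional inverse of `φ`. -/
theorem PowerSeries.coeff_one_sub_sum_lagrange (hp : h * p = 1) (M : ℕ) {m : ℕ} (hm : m < M) :
    coeff m (1 - ∑ j ∈ Finset.range M,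
      C (coeff j (p ^ (j + 1))) * ((X * h) ^ j * derivative K (X * h))) = 0 := by
  set D := 1 - ∑ j ∈ Finset.range M,
      C (coeff j (p ^ (j + 1))) * ((X * h) ^ j * derivative K (X * h)) with hD
  -- The residue functionals are dual to the `φ^j φ'`, so they all kill `D`. They are triangular
  -- with diagonal entries `(constantCoeff p)^(m+1) ≠ 0`, so the coefficients of `D` vanish one by
  -- one.
  have hz : ∀ m < M, coeff m (p ^ (m + 1) * D) = 0 := by
    intro m hm
    rw [hD, mul_sub, mul_one, Finset.mul_sum, map_sub, map_sum, sub_eq_zero]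
    have : ∀ j ∈ Finset.range M, coeff m (p ^ (m + 1) *
        (C (coeff j (p ^ (j + 1))) * ((X * h) ^ j * derivative K (X * h)))) =
        if j = m then coeff j (p ^ (j + 1)) else 0 := by
      intro j _
      rw [mul_left_comm, coeff_C_mul, coeff_pow_mul_pow_mul_derivative_X_mul hp]
      simp
    rw [Finset.sum_congr rfl this, Finset.sum_ite_eq' (Finset.range M) m, if_pos (by simpa using hm)]
  have hp0 : constantCoeff p ≠ 0 := by
    intro h0
    have := congrArg constantCoeff hp
    simp [h0] at this
  induction m using Nat.strong_induction_on with
  | _ m ih =>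
    obtain ⟨E, hE⟩ : X ^ m ∣ D := X_pow_dvd_iff.mpr fun i hi => ih i hi (hi.trans hm)
    have h1 := hz m hm
    rw [hE, mul_left_comm] at h1
    have h2 := coeff_X_pow_mul (p ^ (m + 1) * E) m 0
    rw [zero_add] at h2
    rw [h2, coeff_zero_eq_constantCoeff_apply, map_mul, map_pow] at h1
    have h3 := coeff_X_pow_mul E m 0
    rw [zero_add] at h3
    rw [hE, h3, coeff_zero_eq_constantCoeff_apply]
    exact (mul_eq_zero.mp h1).resolve_left (pow_ne_zero _ hp0)

end LagrangeInversion

/-! ### Taylor series of smooth functions as formal power series -/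

section TaylorSeries

open scoped ContDiff

/-- The Taylor series at `0` of a function of a real variable. -/
noncomputable def taylorPowerSeries (f : ℝ → ℝ) : PowerSeries ℝ :=
  PowerSeries.mk fun j => iteratedDeriv j f 0 / (j.factorial : ℝ)

theorem coeff_taylorPowerSeries (f : ℝ → ℝ) (j : ℕ) :
    PowerSeries.coeff j (taylorPowerSeries f) = iteratedDeriv j f 0 / (j.factorial : ℝ) := by
  simp [taylorPowerSeries]

variable {f g : ℝ → ℝ}

theorem taylorPowerSeries_mul (hf : ContDiff ℝ ∞ f) (hg : ContDiff ℝ ∞ g) :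
    taylorPowerSeries (f * g) = taylorPowerSeries f * taylorPowerSeries g := by
  ext j
  rw [coeff_taylorPowerSeries, PowerSeries.coeff_mul,
    Finset.Nat.sum_antidiagonal_eq_sum_range_succ_mk,
    iteratedDeriv_mul (hf.contDiffAt.of_le (by exact_mod_cast le_top))
      (hg.contDiffAt.of_le (by exact_mod_cast le_top)), Finset.sum_div]
  refine Finset.sum_congr rfl fun i hi => ?_
  have hi : i ≤ j := by simpa [Nat.lt_succ_iff] using hi
  rw [coeff_taylorPowerSeries, coeff_taylorPowerSeries, Nat.cast_choose ℝ hi]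
  have h1 : (i.factorial : ℝ) ≠ 0 := by positivity
  have h2 : ((j - i).factorial : ℝ) ≠ 0 := by positivity
  have h3 : (j.factorial : ℝ) ≠ 0 := by positivity
  field_simp

theorem taylorPowerSeries_const (c : ℝ) :
    taylorPowerSeries (fun _ => c) = PowerSeries.C c := by
  ext j
  rw [coeff_taylorPowerSeries, PowerSeries.coeff_C, iteratedDeriv_const]
  rcases j with _ | j <;> simp

theorem taylorPowerSeries_id : taylorPowerSeries (fun x => x) = PowerSeries.X := by
  ext j
  rw [coeff_taylorPowerSeries, PowerSeries.coeff_X, iteratedDeriv_fun_id_zero]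
  split_ifs with h <;> simp [h]

theorem taylorPowerSeries_pow (hf : ContDiff ℝ ∞ f) (n : ℕ) :
    taylorPowerSeries (f ^ n) = taylorPowerSeries f ^ n := by
  induction n with
  | zero => exact (taylorPowerSeries_const 1).trans (map_one _)
  | succ n ih => rw [pow_succ, taylorPowerSeries_mul (f := f ^ n) (hf.pow n) hf, ih, pow_succ]

theorem taylorPowerSeries_deriv :
    taylorPowerSeries (deriv f) = PowerSeries.derivative ℝ (taylorPowerSeries f) := by
  ext j
  rw [coeff_taylorPowerSeries, PowerSeries.coeff_derivative, coeff_taylorPowerSeries,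
    ← iteratedDeriv_succ', Nat.factorial_succ]
  have h3 : (j.factorial : ℝ) ≠ 0 := by positivity
  push_cast
  field_simp

theorem taylorPowerSeries_sub (hf : ContDiff ℝ ∞ f) (hg : ContDiff ℝ ∞ g) :
    taylorPowerSeries (f - g) = taylorPowerSeries f - taylorPowerSeries g := by
  ext j
  rw [map_sub, coeff_taylorPowerSeries, coeff_taylorPowerSeries, coeff_taylorPowerSeries,
    iteratedDeriv_sub (hf.contDiffAt.of_le (by exact_mod_cast le_top))
      (hg.contDiffAt.of_le (by exact_mod_cast le_top)), sub_div]

theorem taylorPowerSeries_sum {ι : Type*} (s : Finset ι) {F : ι → ℝ → ℝ}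
    (hF : ∀ i ∈ s, ContDiff ℝ ∞ (F i)) :
    taylorPowerSeries (∑ i ∈ s, F i) = ∑ i ∈ s, taylorPowerSeries (F i) := by
  ext j
  rw [map_sum, coeff_taylorPowerSeries, iteratedDeriv_sum fun i hi =>
    (hF i hi).contDiffAt.of_le (by exact_mod_cast le_top), Finset.sum_div]
  simp_rw [coeff_taylorPowerSeries]

theorem isBigO_pow_of_coeff_taylorPowerSeries (hf : ContDiff ℝ ∞ f) {M : ℕ}
    (h : ∀ m < M, PowerSeries.coeff m (taylorPowerSeries f) = 0) :
    f =O[nhds 0] fun x => x ^ M := by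
  have h0 : ∀ m < M, iteratedDeriv m f 0 = 0 := fun m hm => by
    have := h m hm
    rw [coeff_taylorPowerSeries, div_eq_zero_iff] at this
    exact this.resolve_right (by positivity)
  have ht := (taylor_isLittleO_univ (f := f) (x₀ := 0) (n := M)
    (hf.of_le (by exact_mod_cast le_top))).isBigO
  simp only [sub_zero] at ht
  have he : (fun x => taylorWithinEval f M Set.univ 0 x) =O[nhds 0] fun x : ℝ => x ^ M := by
    have : (fun x => taylorWithinEval f M Set.univ 0 x) =
        fun x => ((M.factorial : ℝ)⁻¹ * iteratedDeriv M f 0) * x ^ M := by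
      ext x
      rw [taylor_within_apply, Finset.sum_range_succ, Finset.sum_eq_zero]
      · simp [iteratedDerivWithin_univ]; ring
      · intro m hm
        rw [iteratedDerivWithin_univ, h0 m (by simpa using hm), smul_zero]
    rw [this]
    exact isBigO_const_mul_self _ _ _
  simpa using ht.add he

end TaylorSeries

/-! ### The function G, the phase and its approximate inversion -/

section TruncExp

open scoped ContDiff

theorem hasSum_truncExp (x : ℝ) :
    HasSum (fun j : ℕ => 2 * (x ^ j / ((j + 2).factorial : ℝ))) (truncExp x) := by
  rcases eq_or_ne x 0 with rfl | hx
  · have : truncExp 0 = 2 * ((0 : ℝ) ^ 0 / ((0 + 2).factorial : ℝ)) := by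
      simp [truncExp]
    rw [this]
    refine hasSum_single 0 fun j hj => ?_
    simp [hj]
  · have h := NormedSpace.expSeries_div_hasSum_exp x
    rw [← Real.exp_eq_exp_ℝ, ← hasSum_nat_add_iff' 2] at h
    have h2 := h.mul_left (2 / x ^ 2)
    have e : truncExp x =
        2 / x ^ 2 * (Real.exp x - ∑ i ∈ Finset.range 2, x ^ i / (i.factorial : ℝ)) := by
      simp [truncExp, hx, Finset.sum_range_succ]; ring
    rw [e]
    refine h2.congr_fun fun j => ?_
    rw [pow_add]
    field_simp

theorem sq_mul_truncExp (x : ℝ) : x ^ 2 * truncExp x = 2 * (Real.exp x - 1 - x) := by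
  rcases eq_or_ne x 0 with rfl | hx
  · simp
  · simp [truncExp, hx]; field_simp

theorem truncExp_zero : truncExp 0 = 1 := by simp [truncExp]

theorem truncExp_pos (x : ℝ) : 0 < truncExp x := by
  rcases eq_or_ne x 0 with rfl | hx
  · simp [truncExp]
  · have := Real.add_one_lt_exp hx
    have h2 : 0 < x ^ 2 := by positivity
    have := sq_mul_truncExp x
    by_contra! h
    nlinarith

theorem contDiff_truncExp : ContDiff ℝ ∞ truncExp := by
  set c : ℕ → ℝ := fun j => 2 / ((j + 2).factorial : ℝ) with hc
  have hr : (FormalMultilinearSeries.ofScalars ℝ c).radius = ⊤ := by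
    refine FormalMultilinearSeries.radius_eq_top_of_summable_norm _ fun r => ?_
    refine (hasSum_truncExp r).summable.congr fun j => ?_
    rw [FormalMultilinearSeries.ofScalars_norm, hc, Real.norm_of_nonneg (by positivity)]
    ring
  have hs : HasFPowerSeriesOnBall truncExp (FormalMultilinearSeries.ofScalars ℝ c) 0 ⊤ := by
    refine ⟨hr.ge, by simp, fun {y} _ => ?_⟩
    rw [zero_add]
    refine (hasSum_truncExp y).congr_fun fun j => ?_
    rw [FormalMultilinearSeries.ofScalars_apply_eq, smul_eq_mul, hc]
    ring
  have : AnalyticOnNhd ℝ truncExp Set.univ := by simpa using hs.analyticOnNhd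
  exact contDiffOn_univ.mp (this.contDiffOn uniqueDiffOn_univ)

theorem contDiff_truncExp_rpow (s : ℝ) : ContDiff ℝ ∞ (fun x => truncExp x ^ s) :=
  contDiff_truncExp.rpow_const_of_ne fun x => (truncExp_pos x).ne'

/-- Brings `a_k` to the form `coeff j (p ^ (j + 1))` of Lagrange inversion, with `j = 2k` and `p`
the Taylor series of `G^(-1/2)`. -/
theorem truncExpPow_eq_pow (k : ℕ) : truncExpPow k = truncExpPow 0 ^ (2 * k + 1) := by
  ext x
  rw [Pi.pow_apply, truncExpPow, truncExpPow, ← Real.rpow_natCast,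
    ← Real.rpow_mul (truncExp_pos x).le]
  congr 1
  push_cast
  ring

/-- The function `φ` with `φ x ^ 2 / 2 = e ^ x - 1 - x` and `φ' 0 = 1`. -/
noncomputable def expPhase (x : ℝ) : ℝ := x * truncExp x ^ (1 / 2 : ℝ)

theorem contDiff_expPhase : ContDiff ℝ ∞ expPhase :=
  contDiff_id.mul (contDiff_truncExp_rpow _)

theorem expPhase_sq_div_two (x : ℝ) : expPhase x ^ 2 / 2 = Real.exp x - 1 - x := by
  have h : (truncExp x ^ (1 / 2 : ℝ)) ^ 2 = truncExp x := by
    rw [← Real.rpow_natCast, ← Real.rpow_mul (truncExp_pos x).le]; simp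
  rw [expPhase, mul_pow, h, sq_mul_truncExp]; ring

theorem expPhase_pos {x : ℝ} (hx : 0 < x) : 0 < expPhase x :=
  mul_pos hx (Real.rpow_pos_of_pos (truncExp_pos x) _)

theorem expPhase_neg {x : ℝ} (hx : x < 0) : expPhase x < 0 :=
  mul_neg_of_neg_of_pos hx (Real.rpow_pos_of_pos (truncExp_pos x) _)

/-- The Taylor coefficients of the derivative of the inverse function of `expPhase`. -/
noncomputable def invPhaseCoeff (j : ℕ) : ℝ :=
  PowerSeries.coeff j (taylorPowerSeries (truncExpPow 0) ^ (j + 1))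

/-- The factor in front is the `2k`-th moment of the standard Gaussian. -/
theorem stirlingCoeff_eq (k : ℕ) :
    stirlingCoeff k =
      ((2 * k).factorial : ℝ) / (2 ^ k * (k.factorial : ℝ)) * invPhaseCoeff (2 * k) := by
  rw [stirlingCoeff, invPhaseCoeff, ← taylorPowerSeries_pow (f := truncExpPow 0) (contDiff_truncExp_rpow _),
    ← truncExpPow_eq_pow, coeff_taylorPowerSeries]
  have : ((2 * k).factorial : ℝ) ≠ 0 := by positivity
  field_simp

theorem one_sub_sum_expPhase_isBigO (M : ℕ) :
    (fun x => 1 - ∑ j ∈ Finset.range M, invPhaseCoeff j * (expPhase x ^ j * deriv expPhase x))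
      =O[nhds 0] fun x => x ^ M := by
  have hh := contDiff_truncExp_rpow (1 / 2)
  have hp : ContDiff ℝ ∞ (truncExpPow 0) := contDiff_truncExp_rpow _
  have hφ := contDiff_expPhase
  have hφ' : ContDiff ℝ ∞ (deriv expPhase) := (contDiff_infty_iff_deriv.mp hφ).2
  have h1 : taylorPowerSeries (fun x => truncExp x ^ (1 / 2 : ℝ)) *
      taylorPowerSeries (truncExpPow 0) = 1 := by
    rw [← taylorPowerSeries_mul hh hp, ← map_one (PowerSeries.C (R := ℝ)),
      ← taylorPowerSeries_const]
    congr 1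
    ext x
    rw [Pi.mul_apply, truncExpPow, ← Real.rpow_add (truncExp_pos x)]
    simp
  have h2 : taylorPowerSeries expPhase =
      PowerSeries.X * taylorPowerSeries (fun x => truncExp x ^ (1 / 2 : ℝ)) := by
    rw [← taylorPowerSeries_id, ← taylorPowerSeries_mul (f := fun x => x) contDiff_id hh]
    rfl
  have hterm : ∀ j ∈ Finset.range M,
      ContDiff ℝ ∞ ((fun _ => invPhaseCoeff j) * (expPhase ^ j * deriv expPhase)) := fun j _ =>
    contDiff_const.mul ((hφ.pow j).mul hφ')
  have hsum : ContDiff ℝ ∞ (∑ j ∈ Finset.range M,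
      (fun _ => invPhaseCoeff j) * (expPhase ^ j * deriv expPhase)) := by
    have := ContDiff.sum hterm
    convert this using 1
    ext x; simp
  have e : (fun x => 1 - ∑ j ∈ Finset.range M,
      invPhaseCoeff j * (expPhase x ^ j * deriv expPhase x)) =
      (fun _ => (1 : ℝ)) - ∑ j ∈ Finset.range M,
        (fun _ => invPhaseCoeff j) * (expPhase ^ j * deriv expPhase) := by
    ext x; simp
  rw [e]
  refine isBigO_pow_of_coeff_taylorPowerSeries (f := (fun _ => (1 : ℝ)) - ∑ j ∈ Finset.range M,
    (fun _ => invPhaseCoeff j) * (expPhase ^ j * deriv expPhase))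
    (contDiff_const.sub hsum) fun m hm => ?_
  rw [taylorPowerSeries_sub contDiff_const hsum, taylorPowerSeries_sum _ hterm,
    taylorPowerSeries_const, map_one]
  have : ∀ j ∈ Finset.range M,
      taylorPowerSeries ((fun _ => invPhaseCoeff j) * (expPhase ^ j * deriv expPhase)) =
      PowerSeries.C (invPhaseCoeff j) * (taylorPowerSeries expPhase ^ j *
        PowerSeries.derivative ℝ (taylorPowerSeries expPhase)) := fun j _ => by
    rw [taylorPowerSeries_mul (f := fun _ => invPhaseCoeff j) (g := expPhase ^ j * deriv expPhase)
      contDiff_const ((hφ.pow j).mul hφ'), taylorPowerSeries_const,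
      taylorPowerSeries_mul (f := expPhase ^ j) (hφ.pow j) hφ', taylorPowerSeries_pow hφ,
      taylorPowerSeries_deriv]
  rw [Finset.sum_congr rfl this, h2]
  exact PowerSeries.coeff_one_sub_sum_lagrange h1 M hm

end TruncExp

/-! ### Gaussian moments -/

section GaussianMoments

open MeasureTheory

theorem integrable_pow_mul_exp_neg_sq {b : ℝ} (hb : 0 < b) (j : ℕ) :
    Integrable fun x : ℝ => x ^ j * Real.exp (-(b * (x ^ 2 / 2))) := by
  have := integrable_rpow_mul_exp_neg_mul_sq (half_pos hb) (s := j)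
    (by linarith [Nat.cast_nonneg (α := ℝ) j])
  refine this.congr (ae_of_all _ fun x => ?_)
  simp only [Real.rpow_natCast]
  ring_nf

theorem integral_odd_pow_mul_exp_neg_sq (b : ℝ) (k : ℕ) :
    ∫ x : ℝ, x ^ (2 * k + 1) * Real.exp (-(b * (x ^ 2 / 2))) = 0 := by
  have h := integral_neg_eq_self (fun x : ℝ => x ^ (2 * k + 1) * Real.exp (-(b * (x ^ 2 / 2))))
    volume
  have e : (fun x : ℝ => (-x) ^ (2 * k + 1) * Real.exp (-(b * ((-x) ^ 2 / 2)))) =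
      fun x => -(x ^ (2 * k + 1) * Real.exp (-(b * (x ^ 2 / 2)))) := by
    ext x
    rw [Odd.neg_pow ⟨k, rfl⟩, neg_sq]; ring
  rw [e, integral_neg] at h
  linarith

theorem factorial_two_mul_eq_mul_doubleFactorial (k : ℕ) :
    (2 * k).factorial = 2 ^ k * k.factorial * (2 * k - 1).doubleFactorial := by
  rcases k with _ | k
  · simp
  · rw [← Nat.doubleFactorial_two_mul]
    exact Nat.factorial_eq_mul_doubleFactorial (2 * k + 1)

theorem integral_even_pow_mul_exp_neg_sq {b : ℝ} (hb : 0 < b) (k : ℕ) :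
    ∫ x : ℝ, x ^ (2 * k) * Real.exp (-(b * (x ^ 2 / 2))) =
      Real.sqrt (2 * Real.pi / b) *
        (((2 * k).factorial : ℝ) / (2 ^ k * (k.factorial : ℝ)) / b ^ k) := by
  have h1 : ∫ x : ℝ, x ^ (2 * k) * Real.exp (-(b * (x ^ 2 / 2))) =
      2 * ∫ x in Set.Ioi (0 : ℝ), x ^ ((2 * k : ℕ) : ℝ) * Real.exp (-(b / 2) * x ^ (2 : ℝ)) := by
    rw [← integral_comp_abs (f := fun x =>
      x ^ ((2 * k : ℕ) : ℝ) * Real.exp (-(b / 2) * x ^ (2 : ℝ)))]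
    refine integral_congr_ae (ae_of_all _ fun x => ?_)
    simp only [Real.rpow_natCast, Real.rpow_two, sq_abs, pow_mul]
    ring_nf
  have hk : (-1 : ℝ) < ((2 * k : ℕ) : ℝ) := by
    linarith [Nat.cast_nonneg (α := ℝ) (2 * k)]
  rw [h1, integral_rpow_mul_exp_neg_mul_rpow two_pos hk (half_pos hb)]
  have e1 : (((2 * k : ℕ) : ℝ) + 1) / 2 = k + 1 / 2 := by push_cast; ring
  have e2 : -(((2 * k : ℕ) : ℝ) + 1) / 2 = -((k : ℝ) + 1 / 2) := by push_cast; ring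
  rw [e1, e2, Real.Gamma_nat_add_half, factorial_two_mul_eq_mul_doubleFactorial,
    Real.rpow_neg (half_pos hb).le, Real.rpow_add (half_pos hb), Real.rpow_natCast,
    ← Real.sqrt_eq_rpow, show 2 * Real.pi / b = Real.pi / (b / 2) by field_simp,
    Real.sqrt_div Real.pi_pos.le]
  have : Real.sqrt (b / 2) ≠ 0 := (Real.sqrt_pos.mpr (half_pos hb)).ne'
  have : (k.factorial : ℝ) ≠ 0 := by positivity
  push_cast
  field_simp
  rw [← mul_pow, div_mul_cancel₀ _ two_ne_zero]

end GaussianMoments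

/-! ### Tails of Laplace integrals -/

section LaplaceTail

open MeasureTheory

theorem integrable_mul_exp_neg_nat_mul {w g : ℝ → ℝ} (hw : Continuous w) (hg : Continuous g)
    (hg0 : ∀ x, 0 ≤ g x) (hint : Integrable fun x => w x * Real.exp (-g x)) {n : ℕ} (hn : 1 ≤ n) :
    Integrable fun x => w x * Real.exp (-(n * g x)) := by
  refine hint.mono (by fun_prop) (ae_of_all _ fun x => ?_)
  rw [norm_mul, norm_mul, Real.norm_of_nonneg (Real.exp_pos _).le,
    Real.norm_of_nonneg (Real.exp_pos _).le]
  have h1 : (1 : ℝ) ≤ n := by exact_mod_cast hn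
  have := hg0 x
  gcongr
  nlinarith

/-- In the Laplace integral `∫ w e ^ (-n g)` the part outside an interval containing the minimum of
`g` is negligible to all orders. -/
theorem integral_sub_intervalIntegral_isBigO {w g : ℝ → ℝ} {a b m : ℝ} (hw : Continuous w)
    (hg : Continuous g) (hg0 : ∀ x, 0 ≤ g x) (hab : a ≤ b) (hm : 0 < m)
    (hgm : ∀ x, x ∉ Set.Ioc a b → m ≤ g x)
    (hint : Integrable fun x => w x * Real.exp (-g x)) (K : ℕ) :
    (fun n : ℕ => (∫ x, w x * Real.exp (-(n * g x))) - ∫ x in a..b, w x * Real.exp (-(n * g x)))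
      =O[atTop] fun n : ℕ => 1 / (n : ℝ) ^ K := by
  have hexp : (fun n : ℕ => Real.exp (-m * n)) =O[atTop] fun n : ℕ => 1 / (n : ℝ) ^ K := by
    have := ((isLittleO_exp_neg_mul_rpow_atTop hm (-K)).comp_tendsto
      tendsto_natCast_atTop_atTop).isBigO
    refine this.congr' EventuallyEq.rfl (Eventually.of_forall fun n => ?_)
    simp
  refine IsBigO.trans (IsBigO.of_bound
    (Real.exp m * ∫ x, ‖w x * Real.exp (-g x)‖) ?_) hexp
  filter_upwards [eventually_ge_atTop 1] with n hn
  have h1 : (1 : ℝ) ≤ n := by exact_mod_cast hn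
  have hI := integrable_mul_exp_neg_nat_mul hw hg hg0 hint hn
  rw [intervalIntegral.integral_of_le hab, ← setIntegral_compl measurableSet_Ioc hI]
  -- Off the interval `g ≥ m`, so `e^(-n g) ≤ e^(-(n-1) m) * e^(-g)`; one factor `e^(-g)` is kept
  -- for integrability.
  set c := Real.exp m * Real.exp (-m * n) with hc
  calc ‖∫ x in (Set.Ioc a b)ᶜ, w x * Real.exp (-(n * g x))‖
      ≤ ∫ x in (Set.Ioc a b)ᶜ, c * ‖w x * Real.exp (-g x)‖ := by
        refine norm_integral_le_of_norm_le (hint.norm.const_mul c).integrableOn ?_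
        refine (ae_restrict_iff' measurableSet_Ioc.compl).mpr (ae_of_all _ fun x hx => ?_)
        have hx := hgm x hx
        rw [norm_mul, norm_mul, Real.norm_of_nonneg (Real.exp_pos _).le,
          Real.norm_of_nonneg (Real.exp_pos _).le, mul_left_comm, hc, ← Real.exp_add,
          ← Real.exp_add]
        gcongr
        nlinarith
    _ ≤ ∫ x, c * ‖w x * Real.exp (-g x)‖ :=
        setIntegral_le_integral (hint.norm.const_mul c) (ae_of_all _ fun x => by positivity)
    _ = Real.exp m * (∫ x, ‖w x * Real.exp (-g x)‖) * ‖Real.exp (-m * n)‖ := by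
        rw [integral_const_mul, hc, Real.norm_of_nonneg (Real.exp_pos _).le]; ring

end LaplaceTail

/-! ### The factorial as a Laplace integral -/

section GammaIntegral

open MeasureTheory

theorem range_mul_exp {c : ℝ} (hc : 0 < c) :
    (fun x : ℝ => c * Real.exp x) '' Set.univ = Set.Ioi 0 := by
  ext y
  simp only [Set.image_univ, Set.mem_range, Set.mem_Ioi]
  refine ⟨?_, fun hy => ⟨Real.log (y / c), ?_⟩⟩
  · rintro ⟨x, rfl⟩
    positivity
  · rw [Real.exp_log (div_pos hy hc)]
    field_simp

theorem injOn_mul_exp {c : ℝ} (hc : 0 < c) :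
    Set.InjOn (fun x : ℝ => c * Real.exp x) Set.univ := fun _ _ _ _ h =>
  Real.exp_injective (mul_left_cancel₀ hc.ne' h)

theorem gamma_integrand_comp_mul_exp {n : ℕ} (hn : 1 ≤ n) (x : ℝ) :
    |n * Real.exp x| • (Real.exp (-(n * Real.exp x)) * (n * Real.exp x) ^ ((n : ℝ) - 1)) =
      (n : ℝ) ^ n * Real.exp (-n) * Real.exp (-(n * (Real.exp x - 1 - x))) := by
  have h0 : (0 : ℝ) < n := by exact_mod_cast hn
  have hpos : 0 < n * Real.exp x := by positivity
  rw [abs_of_pos hpos, smul_eq_mul, mul_left_comm, Real.rpow_sub_one hpos.ne',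
    mul_div_cancel₀ _ hpos.ne', Real.rpow_natCast, mul_pow, ← Real.exp_nat_mul,
    mul_left_comm, mul_assoc, ← Real.exp_add, ← Real.exp_add]
  ring_nf

theorem integrable_exp_neg_nat_mul_exp_sub {n : ℕ} (hn : 1 ≤ n) :
    Integrable fun x : ℝ => Real.exp (-(n * (Real.exp x - 1 - x))) := by
  have h0 : (0 : ℝ) < n := by exact_mod_cast hn
  have h := Real.GammaIntegral_convergent h0
  rw [← range_mul_exp h0, integrableOn_image_iff_integrableOn_abs_deriv_smul MeasurableSet.univ
    (fun x _ => ((Real.hasDerivAt_exp x).const_mul (n : ℝ)).hasDerivWithinAt) (injOn_mul_exp h0),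
    integrableOn_univ] at h
  simp_rw [gamma_integrand_comp_mul_exp hn] at h
  refine (integrable_const_mul_iff ?_ _).mp h
  exact (mul_pos (pow_pos h0 n) (Real.exp_pos _)).ne'.isUnit

theorem factorial_eq_integral_exp_neg_nat_mul {n : ℕ} (hn : 1 ≤ n) :
    (n.factorial : ℝ) =
      n * ((n : ℝ) ^ n * Real.exp (-n) * ∫ x : ℝ, Real.exp (-(n * (Real.exp x - 1 - x)))) := by
  have h0 : (0 : ℝ) < n := by exact_mod_cast hn
  rw [← Real.Gamma_nat_eq_factorial, Real.Gamma_add_one h0.ne', Real.Gamma_eq_integral h0,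
    ← range_mul_exp h0, integral_image_eq_integral_abs_deriv_smul MeasurableSet.univ
    (fun x _ => ((Real.hasDerivAt_exp x).const_mul (n : ℝ)).hasDerivWithinAt) (injOn_mul_exp h0)]
  simp_rw [gamma_integrand_comp_mul_exp hn]
  rw [Measure.restrict_univ, integral_const_mul]

end GammaIntegral

/-! ### Assembling the Stirling series -/

section StirlingSeries

open MeasureTheory

theorem exp_sub_one_sub_nonneg (x : ℝ) : 0 ≤ Real.exp x - 1 - x := by
  linarith [Real.add_one_le_exp x]

theorem min_le_exp_sub_one_sub {δ : ℝ} (hδ : 0 < δ) {x : ℝ} (hx : x ∉ Set.Ioc (-δ) δ) :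
    min (Real.exp δ - 1 - δ) (Real.exp (-δ) - 1 - -δ) ≤ Real.exp x - 1 - x := by
  have tangent : ∀ y : ℝ, Real.exp y * (1 + (x - y)) ≤ Real.exp x := fun y => by
    -- Convexity: `exp` lies above its tangents, which are used at `±δ`.
    have h : Real.exp x = Real.exp y * Real.exp (x - y) := by rw [← Real.exp_add]; ring_nf
    rw [h]
    gcongr
    linarith [Real.add_one_le_exp (x - y)]
  rcases le_or_gt x (-δ) with h | h
  · refine (min_le_right _ _).trans ?_
    have h1 : Real.exp (-δ) ≤ 1 := Real.exp_le_one_iff.mpr (by linarith)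
    nlinarith [tangent (-δ)]
  · have h2 : δ < x := by
      by_contra! h3
      exact hx ⟨h, h3⟩
    refine (min_le_left _ _).trans ?_
    have h1 : 1 ≤ Real.exp δ := Real.one_le_exp hδ.le
    nlinarith [tangent δ]

theorem integral_exp_neg_sub_intervalIntegral_isBigO {δ : ℝ} (hδ : 0 < δ) (K : ℕ) :
    (fun n : ℕ => (∫ x : ℝ, Real.exp (-(n * (Real.exp x - 1 - x)))) -
      ∫ x in -δ..δ, Real.exp (-(n * (Real.exp x - 1 - x))))
      =O[atTop] fun n : ℕ => 1 / (n : ℝ) ^ K := by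
  have h1 := Real.add_one_lt_exp hδ.ne'
  have h2 := Real.add_one_lt_exp (neg_ne_zero.mpr hδ.ne')
  have hint := integrable_exp_neg_nat_mul_exp_sub le_rfl
  simp only [Nat.cast_one, one_mul] at hint
  have := integral_sub_intervalIntegral_isBigO (w := fun _ => 1)
    (g := fun x => Real.exp x - 1 - x) (a := -δ) (b := δ) continuous_const (by fun_prop)
    exp_sub_one_sub_nonneg (by linarith)
    (lt_min (by linarith : 0 < Real.exp δ - 1 - δ)
      (by linarith : 0 < Real.exp (-δ) - 1 - -δ))
    (fun x hx => min_le_exp_sub_one_sub hδ hx) (by simpa using hint) K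
  simpa using this

theorem intervalIntegral_expPhase_pow_mul_deriv (δ : ℝ) (j n : ℕ) :
    ∫ x in -δ..δ, expPhase x ^ j * deriv expPhase x * Real.exp (-(n * (Real.exp x - 1 - x))) =
      ∫ u in expPhase (-δ)..expPhase δ, u ^ j * Real.exp (-(n * (u ^ 2 / 2))) := by
  rw [← intervalIntegral.integral_comp_mul_deriv (f := expPhase) (f' := deriv expPhase)
    (fun x _ => (contDiff_expPhase.differentiable (by simp) x).hasDerivAt)
    (contDiff_expPhase.continuous_deriv (by simp)).continuousOn (by fun_prop)]
  refine intervalIntegral.integral_congr fun x _ => ?_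
  simp only [Function.comp, expPhase_sq_div_two]
  ring

theorem integral_pow_sub_intervalIntegral_expPhase_isBigO {δ : ℝ} (hδ : 0 < δ) (j K : ℕ) :
    (fun n : ℕ => (∫ u : ℝ, u ^ j * Real.exp (-(n * (u ^ 2 / 2)))) -
      ∫ x in -δ..δ, expPhase x ^ j * deriv expPhase x * Real.exp (-(n * (Real.exp x - 1 - x))))
      =O[atTop] fun n : ℕ => 1 / (n : ℝ) ^ K := by
  simp_rw [intervalIntegral_expPhase_pow_mul_deriv]
  have h1 := expPhase_pos hδ
  have h2 := expPhase_neg (neg_neg_of_pos hδ)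
  set a := expPhase (-δ)
  set b := expPhase δ
  have hint := integrable_pow_mul_exp_neg_sq one_pos j
  simp only [one_mul] at hint
  refine integral_sub_intervalIntegral_isBigO (w := fun u => u ^ j) (g := fun u => u ^ 2 / 2)
    (m := min (a ^ 2 / 2) (b ^ 2 / 2)) (by fun_prop) (by fun_prop) (fun u => by positivity)
    (by linarith) (lt_min (by nlinarith) (by nlinarith)) (fun u hu => ?_) hint K
  rcases le_or_gt u a with h | h
  · exact (min_le_left _ _).trans (by nlinarith)
  · have h3 : b < u := by
      by_contra! h3
      exact hu ⟨h, h3⟩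
    exact (min_le_right _ _).trans (by nlinarith)

/-- A factor of order `x ^ (2 K)` at the minimum of `e ^ x - 1 - x` gains a factor `1 / n ^ K`. -/
theorem exists_intervalIntegral_mul_exp_isBigO {d : ℝ → ℝ} {K : ℕ}
    (hd : d =O[nhds 0] fun x => x ^ (2 * K)) :
    ∃ δ : ℝ, 0 < δ ∧
      (fun n : ℕ => ∫ x in -δ..δ, d x * Real.exp (-(n * (Real.exp x - 1 - x))))
        =O[atTop] fun n : ℕ => Real.sqrt (2 * Real.pi / n) * (1 / (n : ℝ) ^ K) := by
  obtain ⟨C, hC0, hC⟩ := hd.exists_nonneg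
  -- This gives `e^x - 1 - x ≥ x^2 / 4` near `0`, hence domination by a Gaussian with `n / 2` in
  -- place of `n`; the factors `sqrt 2` and `2 ^ K` below come from that halving.
  have hG : ∀ᶠ x in nhds (0 : ℝ), 1 / 2 < truncExp x :=
    contDiff_truncExp.continuous.continuousAt.eventually_const_lt (by rw [truncExp_zero]; norm_num)
  obtain ⟨ε, hε, h⟩ := Metric.eventually_nhds_iff.mp (hC.bound.and hG)
  refine ⟨ε / 2, half_pos hε, IsBigO.of_bound
    (C * (Real.sqrt 2 * (((2 * K).factorial : ℝ) / (2 ^ K * (K.factorial : ℝ)) * 2 ^ K))) ?_⟩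
  filter_upwards [eventually_ge_atTop 1] with n hn
  have h0 : (0 : ℝ) < n := by exact_mod_cast hn
  have hI := (integrable_pow_mul_exp_neg_sq (half_pos h0) (2 * K)).const_mul C
  have hnn : ∀ x : ℝ, 0 ≤ C * (x ^ (2 * K) * Real.exp (-((n : ℝ) / 2 * (x ^ 2 / 2)))) :=
    fun x => by
      rw [pow_mul]
      positivity
  have hle : -(ε / 2) ≤ ε / 2 := by linarith
  have hbound : ∀ x ∈ Set.Ioc (-(ε / 2)) (ε / 2),
      ‖d x * Real.exp (-(n * (Real.exp x - 1 - x)))‖ ≤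
        C * (x ^ (2 * K) * Real.exp (-((n : ℝ) / 2 * (x ^ 2 / 2)))) := fun x hx => by
    have hxε : dist x 0 < ε := by
      rw [Real.dist_eq, sub_zero, abs_lt]
      constructor <;> linarith [hx.1, hx.2]
    obtain ⟨hx1, hx2⟩ := h hxε
    rw [Real.norm_of_nonneg (r := x ^ (2 * K)) (by rw [pow_mul]; positivity)] at hx1
    rw [norm_mul, Real.norm_of_nonneg (Real.exp_pos _).le, ← mul_assoc]
    have hg : x ^ 2 / 4 ≤ Real.exp x - 1 - x := by
      nlinarith [sq_mul_truncExp x, sq_nonneg x]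
    exact mul_le_mul hx1 (Real.exp_le_exp.mpr (by nlinarith)) (Real.exp_pos _).le
      (by rw [pow_mul]; positivity)
  calc ‖∫ x in -(ε / 2)..ε / 2, d x * Real.exp (-(n * (Real.exp x - 1 - x)))‖
      ≤ ∫ x in -(ε / 2)..ε / 2, C * (x ^ (2 * K) * Real.exp (-((n : ℝ) / 2 * (x ^ 2 / 2)))) :=
        intervalIntegral.norm_integral_le_of_norm_le hle (ae_of_all _ hbound)
          hI.intervalIntegrable
    _ ≤ ∫ x, C * (x ^ (2 * K) * Real.exp (-((n : ℝ) / 2 * (x ^ 2 / 2)))) := by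
        rw [intervalIntegral.integral_of_le hle]
        exact setIntegral_le_integral hI (ae_of_all _ hnn)
    _ = _ := by
        rw [integral_const_mul, integral_even_pow_mul_exp_neg_sq (half_pos h0),
          Real.norm_of_nonneg (by positivity),
          show 2 * Real.pi / ((n : ℝ) / 2) = 2 * (2 * Real.pi / n) by field_simp,
          Real.sqrt_mul (by norm_num), div_pow]
        field_simp

/-- Since `1/n ≤ sqrt (2π/n)`, one spare power of `1/n` brings the tail bounds to the scale of the
main error. -/
theorem one_div_pow_succ_isBigO_sqrt_mul (K : ℕ) :
    (fun n : ℕ => 1 / (n : ℝ) ^ (K + 1))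
      =O[atTop] fun n : ℕ => Real.sqrt (2 * Real.pi / n) * (1 / (n : ℝ) ^ K) := by
  refine IsBigO.of_bound 1 ?_
  filter_upwards [eventually_ge_atTop 1] with n hn
  have h1 : (1 : ℝ) ≤ n := by exact_mod_cast hn
  have h0 : (0 : ℝ) < n := by linarith
  rw [one_mul, Real.norm_of_nonneg (by positivity), Real.norm_of_nonneg (by positivity),
    show 1 / (n : ℝ) ^ (K + 1) = 1 / n * (1 / (n : ℝ) ^ K) by rw [pow_succ]; field_simp]
  gcongr
  refine Real.le_sqrt_of_sq_le ?_
  rw [div_pow, one_pow, div_le_div_iff₀ (by positivity) h0]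
  nlinarith [Real.pi_gt_three, mul_pos h0 h0]

theorem sum_invPhaseCoeff_mul_integral {n : ℕ} (hn : 1 ≤ n) (K : ℕ) :
    ∑ j ∈ Finset.range (2 * K),
      invPhaseCoeff j * ∫ u : ℝ, u ^ j * Real.exp (-(n * (u ^ 2 / 2))) =
    Real.sqrt (2 * Real.pi / n) * ∑ k ∈ Finset.range K, 1 / (n : ℝ) ^ k * stirlingCoeff k := by
  have h0 : (0 : ℝ) < n := by exact_mod_cast hn
  induction K with
  | zero => simp
  | succ K ih =>
    rw [Nat.mul_succ, Finset.sum_range_succ, Finset.sum_range_succ, ih, Finset.sum_range_succ,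
      integral_odd_pow_mul_exp_neg_sq, integral_even_pow_mul_exp_neg_sq h0, stirlingCoeff_eq]
    ring

theorem integral_exp_neg_sub_sum_isBigO (K : ℕ) :
    (fun n : ℕ => (∫ x : ℝ, Real.exp (-(n * (Real.exp x - 1 - x)))) -
      Real.sqrt (2 * Real.pi / n) * ∑ k ∈ Finset.range K, 1 / (n : ℝ) ^ k * stirlingCoeff k)
      =O[atTop] fun n : ℕ => Real.sqrt (2 * Real.pi / n) * (1 / (n : ℝ) ^ K) := by
  obtain ⟨δ, hδ, hd⟩ :=
    exists_intervalIntegral_mul_exp_isBigO (one_sub_sum_expPhase_isBigO (2 * K))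
  have htail := (integral_exp_neg_sub_intervalIntegral_isBigO hδ (K + 1)).trans
    (one_div_pow_succ_isBigO_sqrt_mul K)
  have hterms : (fun n : ℕ => ∑ j ∈ Finset.range (2 * K), invPhaseCoeff j *
      ((∫ u : ℝ, u ^ j * Real.exp (-(n * (u ^ 2 / 2)))) -
      ∫ x in -δ..δ, expPhase x ^ j * deriv expPhase x *
        Real.exp (-(n * (Real.exp x - 1 - x)))))
      =O[atTop] fun n : ℕ => Real.sqrt (2 * Real.pi / n) * (1 / (n : ℝ) ^ K) :=
    IsBigO.fun_sum fun j _ => ((integral_pow_sub_intervalIntegral_expPhase_isBigO hδ j (K + 1)).trans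
      (one_div_pow_succ_isBigO_sqrt_mul K)).const_mul_left _
  -- The error is the tail of the phase integral, plus the local remainder, minus the tails of the
  -- Gaussian moments.
  refine ((htail.add hd).sub hterms).congr' ?_ EventuallyEq.rfl
  filter_upwards [eventually_ge_atTop 1] with n hn
  have hc := contDiff_expPhase.continuous
  have hc' := contDiff_expPhase.continuous_deriv (by simp)
  have hsplit : ∫ x in -δ..δ, (1 - ∑ j ∈ Finset.range (2 * K),
        invPhaseCoeff j * (expPhase x ^ j * deriv expPhase x)) *
        Real.exp (-(n * (Real.exp x - 1 - x))) =
      (∫ x in -δ..δ, Real.exp (-(n * (Real.exp x - 1 - x)))) -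
      ∑ j ∈ Finset.range (2 * K), invPhaseCoeff j * ∫ x in -δ..δ,
        expPhase x ^ j * deriv expPhase x * Real.exp (-(n * (Real.exp x - 1 - x))) := by
    simp_rw [sub_mul, one_mul, Finset.sum_mul, mul_assoc]
    rw [intervalIntegral.integral_sub (Continuous.intervalIntegrable (by fun_prop) _ _)
      (Continuous.intervalIntegrable (by fun_prop) _ _), intervalIntegral.integral_finsetSum
      fun j _ => Continuous.intervalIntegrable (by fun_prop) _ _]
    simp_rw [intervalIntegral.integral_const_mul]
  rw [hsplit, ← sum_invPhaseCoeff_mul_integral hn]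
  simp_rw [mul_sub, Finset.sum_sub_distrib]
  ring

theorem factorial_eq_stirling_mul_integral {n : ℕ} (hn : 1 ≤ n) :
    (n.factorial : ℝ) = Real.sqrt (2 * Real.pi * n) * Real.exp (-(n : ℝ)) * (n : ℝ) ^ n *
      ((Real.sqrt (2 * Real.pi / n))⁻¹ *
        ∫ x : ℝ, Real.exp (-(n * (Real.exp x - 1 - x)))) := by
  have h0 : (0 : ℝ) < n := by exact_mod_cast hn
  have hs : Real.sqrt (2 * Real.pi * n) = n * Real.sqrt (2 * Real.pi / n) := by
    rw [show 2 * Real.pi * (n : ℝ) = (n : ℝ) ^ 2 * (2 * Real.pi / n) by field_simp,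
      Real.sqrt_mul (by positivity), Real.sqrt_sq h0.le]
  have : Real.sqrt (2 * Real.pi / n) ≠ 0 := (Real.sqrt_pos.mpr (by positivity)).ne'
  rw [factorial_eq_integral_exp_neg_nat_mul hn, hs]
  field_simp

theorem hasInvPowExpansion_factorial :
    HasInvPowExpansion (fun n : ℕ => (n.factorial : ℝ))
      (fun n : ℕ => Real.sqrt (2 * Real.pi * n) * Real.exp (-(n : ℝ)) * (n : ℝ) ^ n)
      stirlingCoeff := by
  intro N
  refine ⟨fun n => (Real.sqrt (2 * Real.pi / n))⁻¹ *
    (∫ x : ℝ, Real.exp (-(n * (Real.exp x - 1 - x)))) -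
      ∑ k ∈ Finset.range (N + 1), 1 / (n : ℝ) ^ k * stirlingCoeff k, fun n hn => ?_, ?_⟩
  · rw [add_sub_cancel]
    exact factorial_eq_stirling_mul_integral hn
  · have hs : ∀ᶠ n : ℕ in atTop, Real.sqrt (2 * Real.pi / n) ≠ 0 := by
      filter_upwards [eventually_ge_atTop 1] with n hn
      have h0 : (0 : ℝ) < n := by exact_mod_cast hn
      exact (Real.sqrt_pos.mpr (by positivity)).ne'
    refine ((isBigO_refl (fun n : ℕ => (Real.sqrt (2 * Real.pi / n))⁻¹) atTop).mul
      (integral_exp_neg_sub_sum_isBigO (N + 1))).congr' ?_ ?_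
    · filter_upwards [hs] with n hn
      rw [mul_sub, inv_mul_cancel_left₀ hn]
    · filter_upwards [hs] with n hn
      rw [inv_mul_cancel_left₀ hn]

end StirlingSeries

theorem HasInvPowExpansion.coeff_unique {u p a b : ℕ → ℝ} (hp : ∀ᶠ n in atTop, p n ≠ 0)
    (ha : HasInvPowExpansion u p a) (hb : HasInvPowExpansion u p b) (k : ℕ) : a k = b k := by
  induction k using Nat.strong_induction_on with
  | _ k ih =>
    obtain ⟨R, hR, hRO⟩ := ha k
    obtain ⟨S, hS, hSO⟩ := hb k
    -- Once the earlier terms cancel, `(a k - b k) / n^k` is a difference of remainders of order `1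
    -- / n^(k+1)`; a constant that is `O(1/n)` is zero.
    have hconst : (fun _ : ℕ => a k - b k) =O[atTop] fun n : ℕ => 1 / (n : ℝ) := by
      refine ((isBigO_refl (fun n : ℕ => (n : ℝ) ^ k) atTop).mul (hSO.sub hRO)).congr' ?_ ?_
      · filter_upwards [hp, eventually_ge_atTop 1] with n hpn hn
        have h0 : (n : ℝ) ≠ 0 := by exact_mod_cast (by omega : n ≠ 0)
        have h := mul_left_cancel₀ hpn ((hR n hn).symm.trans (hS n hn))
        rw [Finset.sum_range_succ, Finset.sum_range_succ, Finset.sum_congr rfl fun i hi => by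
          rw [ih i (Finset.mem_range.mp hi)]] at h
        have h2 : S n - R n = 1 / (n : ℝ) ^ k * (a k - b k) := by linear_combination -h
        rw [h2]
        field_simp
      · filter_upwards [eventually_ge_atTop 1] with n hn
        have h0 : (n : ℝ) ≠ 0 := by exact_mod_cast (by omega : n ≠ 0)
        rw [pow_succ]
        field_simp
    have := tendsto_nhds_unique tendsto_const_nhds
      (hconst.trans_tendsto tendsto_one_div_atTop_nhds_zero_nat)
    linarith

theorem theorem1 :
    (∀ x : ℝ, HasSum (fun j : ℕ => 2 * (x ^ j / ((j + 2).factorial : ℝ))) (truncExp x)) ∧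
    (∀ k : ℕ, ContDiffAt ℝ (⊤ : ℕ∞) (truncExpPow k) 0) ∧
    HasInvPowExpansion (fun n : ℕ => (n.factorial : ℝ))
      (fun n : ℕ => Real.sqrt (2 * Real.pi * n) * Real.exp (-(n : ℝ)) * (n : ℝ) ^ n)
      stirlingCoeff ∧
    (∀ b : ℕ → ℝ,
      HasInvPowExpansion (fun n : ℕ => (n.factorial : ℝ))
        (fun n : ℕ => Real.sqrt (2 * Real.pi * n) * Real.exp (-(n : ℝ)) * (n : ℝ) ^ n) b →
      ∀ k : ℕ, b k = stirlingCoeff k) := by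
  refine ⟨hasSum_truncExp, fun k => (contDiff_truncExp_rpow _).contDiffAt,
    hasInvPowExpansion_factorial, fun b hb k =>
      hb.coeff_unique ?_ hasInvPowExpansion_factorial k⟩
  filter_upwards [eventually_ge_atTop 1] with n hn
  have h0 : (0 : ℝ) < n := by exact_mod_cast hn
  positivity
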